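/- Let $v\in C^\infty(\mathbb R)$ be $1$-periodic with $\int_0^1 v\,dx=0$, and let $m,n\in\mathbb R$. Consider the shear flow $V(x,y)=(v(y),0)$ and the gradient direction $(m,n)$; the cell problems of the G-equation without and with the strain term (flame speed and Markstein length normalized to $1$) are the one-dimensional equations $$\sqrt{m^2+(n+u')^2}+m\,v(x)=\lambda \quad\text{in }\mathbb R,\qquad\qquad (1)$$ $$\sqrt{m^2+(n+u')^2}+\frac{m\,(n+u')\,v'(x)}{\sqrt{m^2+(n+u')^2}}+m\,v(x)=\hat\lambda\quad\text{in }\mathbb R,\qquad (2)$$ where the fraction in (2) is read as $0$ when its denominator vanishes (this matters only for $m=0$). There is a unique number $\lambda=\lambda(m,n)$ for which (1) has a continuous $1$-periodic viscosity solution $u$, and a unique number $\hat\lambda=\hat\lambda(m,n)$ for which (2) has one; these are the effective Hamiltonians (turbulent flame speeds) without and with strain. They satisfy $$\lambda(m,n)\ \ge\ \hat\lambda(m,n).$$ Moreover, if $m\neq 0$ and $\lambda(m,n)>|m|+\max_{x\in\mathbb R} m\,v(x)$, then $\lambda(m,n)=\hat\lambda(m,n)$ if and only if $v'\equiv 0$.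 -/

import Mathlib

open scoped ContDiff

/-- `u` is a viscosity subsolution on `ℝ` of the first order equation `F (u', x) = 0`: it is
continuous, and `F (φ' x₀) x₀ ≤ 0` whenever `φ ∈ C¹(ℝ)` and `φ - u` has a minimum at `x₀`. -/
def IsViscositySubsolution (F : ℝ → ℝ → ℝ) (u : ℝ → ℝ) : Prop :=
  Continuous u ∧
    ∀ φ : ℝ → ℝ, ContDiff ℝ 1 φ → ∀ x₀ : ℝ,
      (∀ x : ℝ, φ x₀ - u x₀ ≤ φ x - u x) → F (deriv φ x₀) x₀ ≤ 0

/-- `u` is a viscosity supersolution on `ℝ` of `F (u', x) = 0`: it is continuous, and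
`F (φ' x₀) x₀ ≥ 0` whenever `φ ∈ C¹(ℝ)` and `φ - u` has a maximum at `x₀`. -/
def IsViscositySupersolution (F : ℝ → ℝ → ℝ) (u : ℝ → ℝ) : Prop :=
  Continuous u ∧
    ∀ φ : ℝ → ℝ, ContDiff ℝ 1 φ → ∀ x₀ : ℝ,
      (∀ x : ℝ, φ x - u x ≤ φ x₀ - u x₀) → 0 ≤ F (deriv φ x₀) x₀

/-- `u` is a viscosity solution on `ℝ` of `F (u', x) = 0`. -/
def IsViscositySolution (F : ℝ → ℝ → ℝ) (u : ℝ → ℝ) : Prop :=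
  IsViscositySubsolution F u ∧ IsViscositySupersolution F u

/-- The cell problem `H (n + u', x) = a` on `ℝ` has a `1`-periodic viscosity solution `u`.
The effective Hamiltonian of `H` at `n` is the unique such `a`. -/
def CellProblemSolvable (H : ℝ → ℝ → ℝ) (n a : ℝ) : Prop :=
  ∃ u : ℝ → ℝ, Function.Periodic u 1 ∧ IsViscositySolution (fun p x => H (n + p) x - a) u

/-- The Hamiltonian `|q| + V · q` of the G-equation for the shear flow `V = (v(y), 0)`,
at the gradient `q = (m, p)` and the height `x`. -/
noncomputable def shearHamiltonian (v : ℝ → ℝ) (m p x : ℝ) : ℝ :=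
  √(m ^ 2 + p ^ 2) + m * v x

/-- The Hamiltonian `|q| + V · q + (q / |q|) · DV · q` of the G-equation with strain term for the
shear flow `V = (v(y), 0)`, at the gradient `q = (m, p)` and the height `x`.
The strain term is `0` at `q = 0` (its continuous extension). -/
noncomputable def shearStrainHamiltonian (v : ℝ → ℝ) (m p x : ℝ) : ℝ :=
  √(m ^ 2 + p ^ 2) + m * p * deriv v x / √(m ^ 2 + p ^ 2) + m * v x

/-!
Both Hamiltonians have a modulus of continuity in `x` that is uniform in the slope `p`, so doubling
of variables compares a periodic subsolution at level `a` with a periodic supersolution at level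
`b` and gives `b ≤ a` (`level_le_of_subsolution_of_supersolution`). Effective Hamiltonians are
therefore unique, and are bounded below by exhibiting supersolutions.

*Existence.* For `m ≠ 0` each Hamiltonian is strictly quasiconvex and coercive in `p`, so its level
sets have two continuous branches. Either the mean of one branch takes the value `n` at some level,
which gives a `C¹` corrector, or the level is the largest minimum of the Hamiltonian in `p`; then
the branches meet at some `x₀`, and a corrector follows the upper branch, switches to the lower one
at a concave kink, and returns to the upper one at `x₀` (`cellProblemSolvable_of_branches`).

*Inequality.* By the Cauchy–Schwarz inequality for `(m, p)` and `(m, p + m v')`,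
`shearStrainHamiltonian v m p x ≤ shearHamiltonian v m (p + m v' x) x`. Hence a corrector of the
strained problem plus `m v` is a supersolution of the unstrained one at the same level.

*Equality.* Above the level `|m| + max m v` both problems have `C¹` correctors, of slopes `q` and
`q₀` with mean `n`. If the levels agree, `q + m v'` dominates `q₀ ≠ 0` in absolute value and also
has mean `n`, so the two coincide. This is the equality case of Cauchy–Schwarz, where `v' = 0`.
-/

open Set Filter Topology

/-! ### Comparison -/

/-- Comparison principle for periodic sub- and supersolutions of the same cell problem at two
levels, by doubling of variables. The Hamiltonian need not be coercive, because its modulus of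
continuity in `x` is uniform in `p`. -/
theorem level_le_of_subsolution_of_supersolution {H : ℝ → ℝ → ℝ} {n a b : ℝ} {u w : ℝ → ℝ}
    (hH : ∀ ε > 0, ∃ δ > 0, ∀ p x y, |x - y| < δ → H p y ≤ H p x + ε)
    (hu : Function.Periodic u 1) (hw : Function.Periodic w 1)
    (hsub : IsViscositySubsolution (fun p x => H (n + p) x - a) u)
    (hsup : IsViscositySupersolution (fun p x => H (n + p) x - b) w) : b ≤ a := by
  by_contra! hab
  obtain ⟨δ, hδ, hmod⟩ := hH ((b - a) / 2) (by linarith)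
  obtain ⟨C₁, hC₁⟩ := (hu.isBounded_of_continuous one_ne_zero hsub.1).exists_norm_le
  obtain ⟨C₂, hC₂⟩ := (hw.isBounded_of_continuous one_ne_zero hsup.1).exists_norm_le
  simp only [mem_range, forall_exists_index, forall_apply_eq_imp_iff, Real.norm_eq_abs,
    abs_le] at hC₁ hC₂
  -- With this penalization every pair at distance at least `δ` is worse than a diagonal pair.
  set K : ℝ := (2 * (C₁ + C₂) + 1) / δ ^ 2 with hK
  have hKδ : K * δ ^ 2 = 2 * (C₁ + C₂) + 1 := by rw [hK]; field_simp
  have hK0 : 0 ≤ K := by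
    have := hC₁ 0
    have := hC₂ 0
    rw [hK]; apply div_nonneg <;> nlinarith
  have hcont : Continuous fun z : ℝ × ℝ => u z.1 - w (z.1 - z.2) - K * z.2 ^ 2 := by
    have h1 := hsub.1
    have h2 := hsup.1
    fun_prop
  obtain ⟨⟨x₁, t₁⟩, -, hmax⟩ :=
    (isCompact_Icc.prod isCompact_Icc : IsCompact (Icc (0 : ℝ) 1 ×ˢ Icc (-δ) δ)).exists_isMaxOn
      ⟨(0, 0), by simp [hδ.le]⟩ hcont.continuousOn
  have hfar : ∀ t, δ ≤ |t| → δ ^ 2 ≤ t ^ 2 := fun t ht => by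
    rw [← sq_abs t]; exact pow_le_pow_left₀ hδ.le ht 2
  have hmax01 : ∀ x ∈ Icc (0 : ℝ) 1, ∀ t,
      u x - w (x - t) - K * t ^ 2 ≤ u x₁ - w (x₁ - t₁) - K * t₁ ^ 2 := by
    intro x hx t
    by_cases ht : |t| ≤ δ
    · exact hmax (show (x, t) ∈ Icc (0 : ℝ) 1 ×ˢ Icc (-δ) δ from ⟨hx, abs_le.1 ht⟩)
    · have h0 : u x - w (x - 0) - K * 0 ^ 2 ≤ u x₁ - w (x₁ - t₁) - K * t₁ ^ 2 :=
        hmax (show (x, (0 : ℝ)) ∈ Icc (0 : ℝ) 1 ×ˢ Icc (-δ) δ from ⟨hx, by simp [hδ.le]⟩)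
      have := mul_le_mul_of_nonneg_left (hfar t (not_le.1 ht).le) hK0
      have := hC₁ x
      have := hC₂ (x - t)
      have := hC₂ (x - 0)
      nlinarith
  have hglob : ∀ x t, u x - w (x - t) - K * t ^ 2 ≤ u x₁ - w (x₁ - t₁) - K * t₁ ^ 2 := by
    intro x t
    have h := hmax01 (Int.fract x) ⟨Int.fract_nonneg x, (Int.fract_lt_one x).le⟩ t
    have e1 : u (Int.fract x) = u x := by
      have := hu.sub_int_mul_eq ⌊x⌋ (x := x)
      rwa [mul_one] at this
    have e2 : w (Int.fract x - t) = w (x - t) := by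
      have := hw.sub_int_mul_eq ⌊x⌋ (x := x - t)
      rw [← this, Int.fract]; congr 1; ring
    rwa [e1, e2] at h
  have ht₁ : |t₁| < δ := by
    by_contra! ht
    have h0 := hglob x₁ 0
    have := mul_le_mul_of_nonneg_left (hfar t₁ ht) hK0
    have := hC₂ (x₁ - t₁)
    have := hC₂ (x₁ - 0)
    have := hC₁ 0
    nlinarith
  have d1 : HasDerivAt (fun x => K * (x - (x₁ - t₁)) ^ 2) (2 * K * t₁) x₁ := by
    exact ((((hasDerivAt_id x₁).sub_const (x₁ - t₁)).pow 2).const_mul K).congr_deriv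
      (by simp; ring)
  have d2 : HasDerivAt (fun y => -(K * (x₁ - y) ^ 2)) (2 * K * t₁) (x₁ - t₁) := by
    exact ((((hasDerivAt_id (x₁ - t₁)).const_sub x₁).pow 2).const_mul K).neg.congr_deriv
      (by simp; ring)
  have h1 := hsub.2 (fun x => K * (x - (x₁ - t₁)) ^ 2) (by fun_prop) x₁ (fun x => by
    have h := hglob x (x - (x₁ - t₁))
    rw [sub_sub_cancel] at h
    simp only [sub_sub_cancel]; linarith)
  have h2 := hsup.2 (fun y => -(K * (x₁ - y) ^ 2)) (by fun_prop) (x₁ - t₁) (fun y => by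
    have h := hglob x₁ (x₁ - y)
    rw [sub_sub_cancel] at h
    simp only [sub_sub_cancel]; linarith)
  rw [d1.deriv] at h1
  rw [d2.deriv] at h2
  have h3 := hmod (n + 2 * K * t₁) x₁ (x₁ - t₁) (by rwa [sub_sub_cancel])
  linarith

/-! ### Viscosity solutions with one-sided derivatives -/

/-- A function with left derivative `l` and right derivative `r` at a point can be touched there
from above only with slopes in `[r, l]`, and from below only with slopes in `[l, r]`. -/
theorem isViscositySolution_of_hasDerivWithinAt {F : ℝ → ℝ → ℝ} {u : ℝ → ℝ}
    (h : ∀ x, ∃ l r, HasDerivWithinAt u l (Iic x) x ∧ HasDerivWithinAt u r (Ici x) x ∧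
      (∀ p ∈ Icc r l, F p x ≤ 0) ∧ ∀ p ∈ Icc l r, 0 ≤ F p x) :
    IsViscositySolution F u := by
  have hc : Continuous u := continuous_iff_continuousAt.2 fun x => by
    obtain ⟨l, r, hl, hr, -⟩ := h x
    exact continuousAt_iff_continuous_left_right.2 ⟨hl.continuousWithinAt, hr.continuousWithinAt⟩
  have key : ∀ (f : ℝ → ℝ) (l r x : ℝ), HasDerivWithinAt f l (Iic x) x →
      HasDerivWithinAt f r (Ici x) x → (∀ y, f x ≤ f y) → l ≤ 0 ∧ 0 ≤ r := by
    intro f l r x hl hr hmin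
    rw [hasDerivWithinAt_iff_tendsto_slope] at hl hr
    rw [Iic_sdiff_right] at hl
    rw [Ici_sdiff_left] at hr
    refine ⟨le_of_tendsto hl ?_, ge_of_tendsto hr ?_⟩
    · filter_upwards [self_mem_nhdsWithin] with y (hy : y < x)
      rw [slope_def_field]
      exact div_nonpos_of_nonneg_of_nonpos (sub_nonneg.2 (hmin y)) (by linarith)
    · filter_upwards [self_mem_nhdsWithin] with y (hy : x < y)
      rw [slope_def_field]
      exact div_nonneg (sub_nonneg.2 (hmin y)) (by linarith)
  refine ⟨⟨hc, fun φ hφ x hx => ?_⟩, ⟨hc, fun φ hφ x hx => ?_⟩⟩ <;>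
    obtain ⟨l, r, hl, hr, hsub, hsup⟩ := h x <;>
    have hd := (hφ.differentiable one_ne_zero x).hasDerivAt
  · have := key (fun y => φ y - u y) _ _ x (hd.hasDerivWithinAt.sub hl)
      (hd.hasDerivWithinAt.sub hr) hx
    exact hsub _ ⟨by linarith, by linarith⟩
  · have := key (fun y => u y - φ y) _ _ x (hl.sub hd.hasDerivWithinAt)
      (hr.sub hd.hasDerivWithinAt) (fun y => by linarith [hx y])
    exact hsup _ ⟨by linarith, by linarith⟩

/-- A continuous periodic function `q` solving `H (q, x) = a` is `n + u'` for a `C¹` corrector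
`u` at the mean slope `n = ∫₀¹ q`. -/
theorem cellProblemSolvable_of_continuous {H : ℝ → ℝ → ℝ} {a : ℝ} {q : ℝ → ℝ}
    (hq : Continuous q) (hqp : Function.Periodic q 1) (hHq : ∀ x, H (q x) x = a) :
    CellProblemSolvable H (∫ x in (0 : ℝ)..1, q x) a := by
  set n := ∫ x in (0 : ℝ)..1, q x with hn
  have hi : ∀ s t, IntervalIntegrable (fun y => q y - n) MeasureTheory.volume s t := fun s t =>
    (hq.sub continuous_const).intervalIntegrable s t
  refine ⟨fun x => ∫ y in (0 : ℝ)..x, (q y - n), fun x => ?_,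
    isViscositySolution_of_hasDerivWithinAt fun x => ?_⟩
  · have hp : Function.Periodic (fun y => q y - n) 1 := fun y => by simp only [hqp y]
    have h0 : ∫ y in (0 : ℝ)..1, (q y - n) = 0 := by
      rw [intervalIntegral.integral_sub (hq.intervalIntegrable _ _) (by simp)]
      simp [n]
    simp only
    rw [← intervalIntegral.integral_add_adjacent_intervals (hi 0 x) (hi x (x + 1)),
      hp.intervalIntegral_add_eq x 0, zero_add, h0, add_zero]
  · have hd : HasDerivAt (fun x => ∫ y in (0 : ℝ)..x, (q y - n)) (q x - n) x :=
      ((hq.sub continuous_const : Continuous fun y => q y - n)).integral_hasStrictDerivAt 0 x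
        |>.hasDerivAt
    refine ⟨q x - n, q x - n, hd.hasDerivWithinAt, hd.hasDerivWithinAt, ?_, ?_⟩ <;>
    · rintro p ⟨h1, h2⟩
      rw [le_antisymm h2 h1, add_sub_cancel, hHq, sub_self]

/-! ### Branches of the level sets of a quasiconvex Hamiltonian -/

theorem exists_continuous_inverse {K : ℝ → ℝ → ℝ} (hK : Continuous fun z : ℝ × ℝ => K z.1 z.2)
    (hmono : ∀ x, StrictMono fun p => K p x) (htop : ∀ x, Tendsto (fun p => K p x) atTop atTop)
    (hbot : ∀ x, Tendsto (fun p => K p x) atBot atBot) :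
    ∃ P : ℝ → ℝ → ℝ, (Continuous fun z : ℝ × ℝ => P z.1 z.2) ∧ ∀ a x, K (P a x) x = a := by
  have hsurj : ∀ a x, ∃ p, K p x = a := fun a x =>
    Continuous.surjective (hK.comp (by fun_prop : Continuous fun p : ℝ => (p, x)))
      (htop x) (hbot x) a
  choose P hP using hsurj
  refine ⟨P, continuous_iff_continuousAt.2 fun z => tendsto_order.2 ⟨fun p hp => ?_,
    fun p hp => ?_⟩, hP⟩
  · have ho : IsOpen {z : ℝ × ℝ | K p z.2 < z.1} :=
      isOpen_lt (hK.comp (by fun_prop : Continuous fun z : ℝ × ℝ => (p, z.2))) continuous_fst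
    filter_upwards [ho.mem_nhds (show K p z.2 < z.1 by
      simpa only [hP] using hmono z.2 hp)] with y (hy : K p y.2 < y.1)
    rw [← hP y.1 y.2] at hy
    exact (hmono y.2).lt_iff_lt.1 hy
  · have ho : IsOpen {z : ℝ × ℝ | z.1 < K p z.2} :=
      isOpen_lt continuous_fst (hK.comp (by fun_prop : Continuous fun z : ℝ × ℝ => (p, z.2)))
    filter_upwards [ho.mem_nhds (show z.1 < K p z.2 by
      simpa only [hP] using hmono z.2 hp)] with y (hy : y.1 < K p y.2)
    rw [← hP y.1 y.2] at hy
    exact (hmono y.2).lt_iff_lt.1 hy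

/-- If `H (·, x)` increases strictly to `∞` on `[c x, ∞)`, the upper solution `P a x` of
`H (P a x, x) = a` depends continuously on the level and the position, and its mean takes every
value above the one at a given level. At the levels `a < H (c x, x)`, which have no solution,
`P a x` is an extension that keeps it continuous. -/
theorem exists_upper_branch {H : ℝ → ℝ → ℝ} {c : ℝ → ℝ}
    (hH : Continuous fun z : ℝ × ℝ => H z.1 z.2) (hHp : ∀ p, Function.Periodic (H p) 1)
    (hc : Continuous c) (hcp : Function.Periodic c 1)
    (hmono : ∀ x, StrictMonoOn (fun p => H p x) (Ici (c x)))
    (htop : ∀ x, Tendsto (fun p => H p x) atTop atTop) :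
    ∃ P : ℝ → ℝ → ℝ, (∀ a, Continuous (P a)) ∧ (∀ a, Function.Periodic (P a) 1) ∧
      (∀ a x, H (c x) x ≤ a → c x ≤ P a x ∧ H (P a x) x = a) ∧
      ∀ n a₀, ∫ x in (0 : ℝ)..1, P a₀ x ≤ n → ∃ a ≥ a₀, ∫ x in (0 : ℝ)..1, P a x = n := by
  -- Below `c x` the Hamiltonian is replaced by a line of slope one, so that it becomes invertible.
  set K : ℝ → ℝ → ℝ := fun p x => H (max p (c x)) x + min (p - c x) 0 with hKdef
  have hK : Continuous fun z : ℝ × ℝ => K z.1 z.2 := by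
    have : Continuous fun z : ℝ × ℝ => H (max z.1 (c z.2)) z.2 :=
      hH.comp (by fun_prop : Continuous fun z : ℝ × ℝ => (max z.1 (c z.2), z.2))
    simp only [hKdef]
    fun_prop
  have hKmono : ∀ x, StrictMono fun p => K p x := by
    intro x p q hpq
    simp only [hKdef]
    rcases lt_or_ge p (c x) with hp | hp
    · have h1 : H (max p (c x)) x ≤ H (max q (c x)) x :=
        (hmono x).monotoneOn (mem_Ici.2 (le_max_right _ _)) (mem_Ici.2 (le_max_right _ _))
          (max_le_max_right _ hpq.le)
      have h2 : min (p - c x) 0 < min (q - c x) 0 := by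
        rw [min_eq_left (by linarith)]
        exact lt_min (by linarith) (by linarith)
      linarith
    · have h1 : H (max p (c x)) x < H (max q (c x)) x := by
        rw [max_eq_left hp, max_eq_left (hp.trans hpq.le)]
        exact hmono x hp (hp.trans hpq.le) hpq
      rw [min_eq_right (by linarith), min_eq_right (by linarith)]
      linarith
  have hKp : ∀ p, Function.Periodic (K p) 1 := fun p x => by
    simp only [hKdef, hcp x, hHp _ x]
  obtain ⟨P, hP, hKP⟩ := exists_continuous_inverse hK hKmono
    (fun x => (htop x).congr' (by
      filter_upwards [eventually_ge_atTop (c x)] with p hp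
      simp only [hKdef]
      rw [max_eq_left hp, min_eq_right (by linarith), add_zero]))
    (fun x => by
      have h1 : Tendsto (fun p => H (c x) x + (p - c x)) atBot atBot :=
        tendsto_atBot_add_const_left _ _ (tendsto_atBot_add_const_right _ _ tendsto_id)
      refine h1.congr' ?_
      filter_upwards [eventually_le_atBot (c x)] with p hp
      simp only [hKdef]
      rw [max_eq_right hp, min_eq_left (by linarith)])
  have hPc : ∀ a, Continuous (P a) := fun a =>
    hP.comp (by fun_prop : Continuous fun x : ℝ => (a, x))
  refine ⟨P, hPc, fun a x => ?_, fun a x ha => ?_, fun n a₀ hn => ?_⟩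
  · refine (hKmono x).injective ?_
    rw [hKP, ← hKp, hKP]
  · have h := hKP a x
    simp only [hKdef] at h
    rcases lt_or_ge (P a x) (c x) with hp | hp
    · rw [max_eq_right hp.le, min_eq_left (by linarith)] at h
      linarith
    · rw [max_eq_left hp, min_eq_right (by linarith), add_zero] at h
      exact ⟨hp, h⟩
  · obtain ⟨B, hB⟩ := ((hKp n).isBounded_of_continuous one_ne_zero
      (hK.comp (by fun_prop : Continuous fun x : ℝ => (n, x)))).exists_norm_le
    simp only [mem_range, forall_exists_index, forall_apply_eq_imp_iff] at hB
    have hge : ∀ x, n ≤ P (max a₀ B) x := fun x => by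
      rw [← (hKmono x).le_iff_le, hKP]
      exact ((le_abs_self _).trans (hB x)).trans (le_max_right _ _)
    have h1 : n ≤ ∫ x in (0 : ℝ)..1, P (max a₀ B) x := by
      have := intervalIntegral.integral_mono_on (μ := MeasureTheory.volume) zero_le_one
        (continuous_const.intervalIntegrable (0 : ℝ) 1)
        ((hPc (max a₀ B)).intervalIntegrable 0 1) (fun x _ => hge x)
      simpa using this
    obtain ⟨a, ha, han⟩ := intermediate_value_Icc (le_max_left a₀ B)
      (intervalIntegral.continuous_parametric_intervalIntegral_of_continuous'
        (f := P) (μ := MeasureTheory.volume) hP 0 1).continuousOn ⟨hn, h1⟩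
    exact ⟨a, ha.1, han⟩

/-! ### Correctors for the cell problem of a quasiconvex Hamiltonian -/

/-- A corrector with a kink: its slope is `p₊ - n` up to a point where it switches to `p₋ - n`,
and it returns to `p₊ - n` at a point where the two branches meet. -/
theorem cellProblemSolvable_of_branches {H : ℝ → ℝ → ℝ} {n a x₀ : ℝ} {pl pr : ℝ → ℝ}
    (hpl : Continuous pl) (hpr : Continuous pr)
    (hplp : Function.Periodic pl 1) (hprp : Function.Periodic pr 1)
    (hHl : ∀ x, H (pl x) x = a) (hHr : ∀ x, H (pr x) x = a) (hle : ∀ x, pl x ≤ pr x)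
    (hsub : ∀ x, ∀ p ∈ Icc (pl x) (pr x), H p x ≤ a) (hx₀ : pl x₀ = pr x₀)
    (hnl : ∫ x in (0 : ℝ)..1, pl x ≤ n) (hnr : n ≤ ∫ x in (0 : ℝ)..1, pr x) :
    CellProblemSolvable H n a := by
  set f₁ : ℝ → ℝ := fun x => ∫ y in x₀..x, (pr y - n) with hf₁
  set f₂ : ℝ → ℝ := fun x => ∫ y in (x₀ + 1)..x, (pl y - n) with hf₂
  have d₁ : ∀ x, HasDerivAt f₁ (pr x - n) x := fun x =>
    ((hpr.sub continuous_const : Continuous fun y => pr y - n)).integral_hasStrictDerivAt x₀ x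
      |>.hasDerivAt
  have d₂ : ∀ x, HasDerivAt f₂ (pl x - n) x := fun x =>
    ((hpl.sub continuous_const : Continuous fun y => pl y - n)).integral_hasStrictDerivAt _ x
      |>.hasDerivAt
  have e₁ : f₁ x₀ = 0 := intervalIntegral.integral_same
  have e₂ : f₂ (x₀ + 1) = 0 := intervalIntegral.integral_same
  have e₃ : 0 ≤ f₁ (x₀ + 1) := by
    simp only [hf₁]
    rw [intervalIntegral.integral_sub (hpr.intervalIntegrable _ _) (by simp),
      hprp.intervalIntegral_add_eq x₀ 0]
    simpa using hnr
  have e₄ : 0 ≤ f₂ x₀ := by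
    simp only [hf₂]
    rw [intervalIntegral.integral_symm,
      intervalIntegral.integral_sub (hpl.intervalIntegrable _ _) (by simp),
      hplp.intervalIntegral_add_eq x₀ 0]
    simpa using hnl
  obtain ⟨d, hd, hfd⟩ : ∃ d ∈ Icc x₀ (x₀ + 1), f₁ d - f₂ d = 0 := by
    have hcont : ContinuousOn (fun x => f₁ x - f₂ x) (Icc x₀ (x₀ + 1)) := fun x _ =>
      ((d₁ x).sub (d₂ x)).continuousAt.continuousWithinAt
    exact intermediate_value_Icc (by linarith) hcont ⟨by linarith, by linarith⟩
  set g : ℝ → ℝ := fun x => if x ≤ d then f₁ x else f₂ x with hg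
  have g₁ : ∀ x, x ≤ d → g x = f₁ x := fun x hx => if_pos hx
  have g₂ : ∀ x, d ≤ x → g x = f₂ x := fun x hx => by
    rcases hx.eq_or_lt with rfl | hx
    · rw [g₁ d le_rfl]; linarith
    · exact if_neg (not_le.2 hx)
  have hg0 : g x₀ = g (x₀ + 1) := by rw [g₁ _ hd.1, g₂ _ hd.2, e₁, e₂]
  have gr : ∀ z, HasDerivWithinAt g ((if z < d then pr z else pl z) - n) (Ici z) z := by
    intro z
    split_ifs with hz
    · refine (d₁ z).hasDerivWithinAt.congr_of_eventuallyEq ?_ (g₁ z hz.le)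
      filter_upwards [mem_nhdsWithin_of_mem_nhds (Iio_mem_nhds hz)] with y hy using g₁ y hy.le
    · exact (d₂ z).hasDerivWithinAt.congr (fun y hy => g₂ y ((not_lt.1 hz).trans hy))
        (g₂ z (not_lt.1 hz))
  have gl : ∀ z, HasDerivWithinAt g ((if z ≤ d then pr z else pl z) - n) (Iic z) z := by
    intro z
    split_ifs with hz
    · exact (d₁ z).hasDerivWithinAt.congr (fun y hy => g₁ y (le_trans hy hz)) (g₁ z hz)
    · rw [not_le] at hz
      refine (d₂ z).hasDerivWithinAt.congr_of_eventuallyEq ?_ (g₂ z hz.le)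
      filter_upwards [mem_nhdsWithin_of_mem_nhds (Ioi_mem_nhds hz)] with y hy
        using g₂ y (le_of_lt hy)
  have hper : ∀ {q : ℝ → ℝ}, Function.Periodic q 1 → ∀ (x : ℝ) (k : ℤ), q (x - k) = q x :=
    fun hq x k => by simpa using hq.sub_int_mul_eq k (x := x)
  refine ⟨fun x => g (x - ⌊x - x₀⌋), fun x => ?_,
    isViscositySolution_of_hasDerivWithinAt fun x => ?_⟩
  · have : x + 1 - x₀ = x - x₀ + 1 := by ring
    simp only [this, Int.floor_add_one]
    congr 1; push_cast; ring
  · set k : ℤ := ⌊x - x₀⌋ with hk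
    set j : ℤ := ⌈x - x₀⌉ - 1 with hj
    have hur : HasDerivWithinAt (fun x => g (x - ⌊x - x₀⌋))
        ((if x - k < d then pr x else pl x) - n) (Ici x) x := by
      have h := (gr (x - k)).comp x ((hasDerivWithinAt_id x (Ici x)).sub_const (k : ℝ))
        (fun y (hy : x ≤ y) => show x - k ≤ y - k by linarith)
      rw [mul_one, hper hprp, hper hplp] at h
      refine h.congr_of_eventuallyEq ?_ rfl
      have hx : x < k + 1 + x₀ := by linarith [Int.lt_floor_add_one (x - x₀)]
      filter_upwards [self_mem_nhdsWithin, mem_nhdsWithin_of_mem_nhds (Iio_mem_nhds hx)]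
        with y (hy : x ≤ y) (hy' : y < k + 1 + x₀)
      have : ⌊y - x₀⌋ = k := Int.floor_eq_iff.2
        ⟨by linarith [Int.floor_le (x - x₀)], by linarith⟩
      simp [this]
    have hul : HasDerivWithinAt (fun x => g (x - ⌊x - x₀⌋))
        ((if x - j ≤ d then pr x else pl x) - n) (Iic x) x := by
      have h := (gl (x - j)).comp x ((hasDerivWithinAt_id x (Iic x)).sub_const (j : ℝ))
        (fun y (hy : y ≤ x) => show y - j ≤ x - j by linarith)
      rw [mul_one, hper hprp, hper hplp] at h
      have hjc : (j : ℝ) = ⌈x - x₀⌉ - 1 := by rw [hj]; push_cast; ring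
      have hx : j + x₀ < x := by linarith [Int.ceil_lt_add_one (x - x₀)]
      have hu : ∀ y, y ≤ x → j + x₀ < y → g (y - ⌊y - x₀⌋) = g (y - j) := by
        intro y hy hy'
        have hy1 : y - x₀ ≤ j + 1 := by linarith [Int.le_ceil (x - x₀)]
        rcases hy1.eq_or_lt with h1 | h1
        · have : ⌊y - x₀⌋ = j + 1 := by rw [h1]; exact_mod_cast Int.floor_intCast (j + 1)
          rw [this, show y = x₀ + j + 1 by linarith]
          push_cast
          rw [show x₀ + j + 1 - ((j : ℝ) + 1) = x₀ by ring,
            show x₀ + j + 1 - (j : ℝ) = x₀ + 1 by ring, hg0]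
        · have : ⌊y - x₀⌋ = j := Int.floor_eq_iff.2 ⟨by linarith, h1⟩
          rw [this]
      refine h.congr_of_eventuallyEq ?_ (hu x le_rfl hx)
      filter_upwards [self_mem_nhdsWithin, mem_nhdsWithin_of_mem_nhds (Ioi_mem_nhds hx)]
        with y hy hy' using hu y hy hy'
    refine ⟨_, _, hul, hur, fun p hp => ?_, fun p hp => ?_⟩
    · have h1 : pl x ≤ if x - k < d then pr x else pl x := by split_ifs <;> simp [hle]
      have h2 : (if x - j ≤ d then pr x else pl x) ≤ pr x := by split_ifs <;> simp [hle]
      exact sub_nonpos.2 (hsub x _ ⟨by linarith [hp.1], by linarith [hp.2]⟩)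
    · obtain ⟨h1, h2⟩ := hp
      refine sub_nonneg.2 (le_of_eq ?_)
      have hlex := hle x
      split_ifs at h1 h2 with h3 h4 h4
      · rw [show n + p = pr x by linarith, hHr]
      · rw [show n + p = pr x by linarith, hHr]
      · -- The slope jumps upwards only at the translates of `x₀`, where the branches meet.
        have hkj : j ≠ k := by rintro h; rw [h] at h3; exact h3 h4.le
        have hint : x = x₀ + k := by
          by_contra hne
          refine hkj ?_
          have : ⌈x - x₀⌉ = k + 1 := Int.ceil_eq_iff.2
            ⟨by
              push_cast
              rw [add_sub_cancel_right]
              exact lt_of_le_of_ne (Int.floor_le _) fun h => hne (by linarith),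
             by push_cast; exact (Int.lt_floor_add_one _).le⟩
          rw [hj, this, add_sub_cancel_right]
        have e : pl x = pr x := by
          rw [← hper hplp x k, ← hper hprp x k, hint, add_sub_cancel_right, hx₀]
        rw [show n + p = pr x by linarith, hHr]
      · rw [show n + p = pl x by linarith, hHl]

/-- Existence of the effective Hamiltonian of a coercive, strictly quasiconvex Hamiltonian with
minimizer `c x`: its level is a minimum of `H (·, x)` for some `x`, or the corrector is `C¹`. -/
theorem exists_cellProblemSolvable_of_quasiconvex {H : ℝ → ℝ → ℝ} {c : ℝ → ℝ}
    (hH : Continuous fun z : ℝ × ℝ => H z.1 z.2) (hHp : ∀ p, Function.Periodic (H p) 1)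
    (hc : Continuous c) (hcp : Function.Periodic c 1)
    (hmono : ∀ x, StrictMonoOn (fun p => H p x) (Ici (c x)))
    (hanti : ∀ x, StrictAntiOn (fun p => H p x) (Iic (c x)))
    (htop : ∀ x, Tendsto (fun p => H p x) atTop atTop)
    (hbot : ∀ x, Tendsto (fun p => H p x) atBot atTop) (n : ℝ) :
    ∃ a, CellProblemSolvable H n a ∧ ((∃ x, a = H (c x) x) ∨
      ∃ q : ℝ → ℝ, Continuous q ∧ Function.Periodic q 1 ∧ ∫ x in (0 : ℝ)..1, q x = n ∧
        ∀ x, H (q x) x = a) := by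
  obtain ⟨P, hPc, hPp, hPH, hPn⟩ := exists_upper_branch hH hHp hc hcp hmono htop
  obtain ⟨Q, hQc, hQp, hQH, hQn⟩ := exists_upper_branch (H := fun p x => H (-p) x)
    (c := fun x => -c x)
    (hH.comp (by fun_prop : Continuous fun z : ℝ × ℝ => (-z.1, z.2))) (fun p => hHp (-p)) hc.neg
    (fun x => by simp only [hcp x])
    (fun x p hp q hq hpq => hanti x (mem_Iic.2 (neg_le.1 hq)) (mem_Iic.2 (neg_le.1 hp))
      (neg_lt_neg hpq))
    (fun x => (hbot x).comp tendsto_neg_atTop_atBot)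
  have hMc : Continuous fun x => H (c x) x :=
    hH.comp (by fun_prop : Continuous fun x : ℝ => (c x, x))
  have hMp : Function.Periodic (fun x => H (c x) x) 1 := fun x => by
    simp only [hcp x, hHp _ x]
  obtain ⟨x₀, -, hmax⟩ := isCompact_Icc.exists_isMaxOn (nonempty_Icc.2 (zero_le_one (α := ℝ)))
    hMc.continuousOn
  have hx₀ : ∀ x, H (c x) x ≤ H (c x₀) x₀ := fun x => by
    obtain ⟨y, hy, hxy⟩ := hMp.exists_mem_Ico₀ one_pos x
    exact hxy.le.trans (hmax ⟨hy.1, hy.2.le⟩)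
  have hQH' : ∀ a x, H (c x) x ≤ a → -Q a x ≤ c x ∧ H (-Q a x) x = a := fun a x ha => by
    have := hQH a x (by simpa using ha)
    exact ⟨by linarith [this.1], this.2⟩
  rcases le_total (∫ x in (0 : ℝ)..1, P (H (c x₀) x₀) x) n with h | h
  · obtain ⟨a, ha, han⟩ := hPn _ _ h
    have hsol := fun x => (hPH a x ((hx₀ x).trans ha)).2
    exact ⟨a, han ▸ cellProblemSolvable_of_continuous (hPc a) (hPp a) hsol,
      .inr ⟨P a, hPc a, hPp a, han, hsol⟩⟩
  rcases le_total (∫ x in (0 : ℝ)..1, Q (H (c x₀) x₀) x) (-n) with h' | h'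
  · obtain ⟨a, ha, han⟩ := hQn _ _ h'
    have hsol := fun x => (hQH' a x ((hx₀ x).trans ha)).2
    have hp : Function.Periodic (fun x => -Q a x) 1 := fun x => by simp only [hQp a x]
    have hn : ∫ x in (0 : ℝ)..1, -Q a x = n := by
      rw [intervalIntegral.integral_neg, han, neg_neg]
    exact ⟨a, hn ▸ cellProblemSolvable_of_continuous (hQc a).neg hp hsol,
      .inr ⟨_, (hQc a).neg, hp, hn, hsol⟩⟩
  · refine ⟨_, cellProblemSolvable_of_branches (x₀ := x₀) (hQc _).neg (hPc (H (c x₀) x₀))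
      (fun x => by simp only [Pi.neg_apply, hQp _ x]) (hPp _) (fun x => (hQH' _ x (hx₀ x)).2)
      (fun x => (hPH _ x (hx₀ x)).2)
      (fun x => (hQH' _ x (hx₀ x)).1.trans (hPH _ x (hx₀ x)).1) (fun x p hp => ?_) ?_ ?_ h,
      .inl ⟨x₀, rfl⟩⟩
    · rcases le_total p (c x) with hpc | hpc
      · refine ((hanti x).antitoneOn (hQH' _ x (hx₀ x)).1 hpc hp.1).trans ?_
        exact (hQH' _ x (hx₀ x)).2.le
      · refine ((hmono x).monotoneOn hpc (hPH _ x (hx₀ x)).1 hp.2).trans ?_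
        exact (hPH _ x (hx₀ x)).2.le
    · have h1 := (hmono x₀).injOn (hPH _ x₀ le_rfl).1 (mem_Ici.2 le_rfl) (hPH _ x₀ le_rfl).2
      have h2 := (hanti x₀).injOn (hQH' _ x₀ le_rfl).1 (mem_Iic.2 le_rfl) (hQH' _ x₀ le_rfl).2
      exact h2.trans h1.symm
    · simp only [Pi.neg_apply, intervalIntegral.integral_neg]
      linarith

/-! ### The two Hamiltonians -/

theorem uniformContinuous_of_periodic {f : ℝ → ℝ} (hf : Continuous f)
    (hfp : Function.Periodic f 1) : UniformContinuous f := by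
  rw [Metric.uniformContinuous_iff]
  intro ε hε
  obtain ⟨δ, hδ, h⟩ := Metric.uniformContinuousOn_iff.1
    ((isCompact_Icc (a := (-1 : ℝ)) (b := 2)).uniformContinuousOn_of_continuous hf.continuousOn) ε hε
  refine ⟨min δ 1, lt_min hδ one_pos, fun {x y} hxy => ?_⟩
  have hf' : ∀ z, f (z - ⌊x⌋) = f z := fun z => by simpa using hfp.sub_int_mul_eq ⌊x⌋ (x := z)
  have h1 := Int.floor_le x
  have h2 := Int.lt_floor_add_one x
  have h3 := abs_lt.1 (hxy.trans_le (min_le_right _ _))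
  rw [← hf' x, ← hf' y]
  refine h _ ⟨by linarith, by linarith⟩ _ ⟨by linarith, by linarith⟩ ?_
  rw [dist_sub_right]
  exact hxy.trans_le (min_le_left _ _)

/-- The Hamiltonian of the strained G-equation with a free function `b` in place of `v'`. The value
`b = v'` gives the Hamiltonian with strain term, and `b = 0` the one without. -/
noncomputable def strainFamily (b v : ℝ → ℝ) (m p x : ℝ) : ℝ :=
  √(m ^ 2 + p ^ 2) + m * p * b x / √(m ^ 2 + p ^ 2) + m * v x

theorem strainFamily_zero (v : ℝ → ℝ) (m : ℝ) :
    strainFamily (fun _ => 0) v m = shearHamiltonian v m := by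
  funext p x
  simp [strainFamily, shearHamiltonian]

theorem abs_div_sqrt_add_sq_le_one (m p : ℝ) : |p / √(m ^ 2 + p ^ 2)| ≤ 1 := by
  rw [abs_div, abs_of_nonneg (Real.sqrt_nonneg _)]
  refine div_le_one_of_le₀ ?_ (Real.sqrt_nonneg _)
  exact Real.abs_le_sqrt (by nlinarith [sq_nonneg m])

theorem strainFamily_modulus {b v : ℝ → ℝ} (hb : Continuous b) (hbp : Function.Periodic b 1)
    (hv : Continuous v) (hvp : Function.Periodic v 1) (m : ℝ) :
    ∀ ε > 0, ∃ δ > 0, ∀ p x y, |x - y| < δ →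
      strainFamily b v m p y ≤ strainFamily b v m p x + ε := by
  intro ε hε
  have hu : ∀ f : ℝ → ℝ, Continuous f → Function.Periodic f 1 → ∃ δ > 0, ∀ x y, |x - y| < δ →
      |m * f x - m * f y| < ε / 2 := fun f hf hfp => by
    have h1 : Function.Periodic (fun x => m * f x) 1 := fun x => by simp only [hfp x]
    obtain ⟨δ, hδ, h⟩ := Metric.uniformContinuous_iff.1
      (uniformContinuous_of_periodic (continuous_const.mul hf) h1)
      (ε / 2) (by linarith)
    exact ⟨δ, hδ, fun x y hxy => h hxy⟩
  obtain ⟨δ₁, hδ₁, h₁⟩ := hu b hb hbp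
  obtain ⟨δ₂, hδ₂, h₂⟩ := hu v hv hvp
  refine ⟨min δ₁ δ₂, lt_min hδ₁ hδ₂, fun p x y hxy => ?_⟩
  have e₁ := h₁ x y (hxy.trans_le (min_le_left _ _))
  have e₂ := (abs_lt.1 (h₂ x y (hxy.trans_le (min_le_right _ _)))).1
  have e₃ : |p / √(m ^ 2 + p ^ 2) * (m * b x - m * b y)| ≤ ε / 2 := by
    rw [abs_mul]
    calc _ ≤ 1 * |m * b x - m * b y| :=
          mul_le_mul_of_nonneg_right (abs_div_sqrt_add_sq_le_one m p) (abs_nonneg _)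
      _ ≤ ε / 2 := by rw [one_mul]; exact e₁.le
  have e₄ : m * p * b x / √(m ^ 2 + p ^ 2) - m * p * b y / √(m ^ 2 + p ^ 2)
      = p / √(m ^ 2 + p ^ 2) * (m * b x - m * b y) := by ring
  have e₅ := (abs_le.1 e₃).1
  simp only [strainFamily]
  linarith

/-- The effective Hamiltonian is unique. -/
theorem cellProblemSolvable_strainFamily_unique {b v : ℝ → ℝ} (hb : Continuous b)
    (hbp : Function.Periodic b 1) (hv : Continuous v) (hvp : Function.Periodic v 1) {m n a a' : ℝ}
    (h : CellProblemSolvable (strainFamily b v m) n a)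
    (h' : CellProblemSolvable (strainFamily b v m) n a') : a = a' := by
  obtain ⟨u, hu, hus⟩ := h
  obtain ⟨w, hw, hws⟩ := h'
  have hmod := strainFamily_modulus hb hbp hv hvp m
  exact le_antisymm (level_le_of_subsolution_of_supersolution hmod hw hu hws.1 hus.2)
    (level_le_of_subsolution_of_supersolution hmod hu hw hus.1 hws.2)

theorem sqrt_sq_add_sq_pos {m : ℝ} (hm : m ≠ 0) (p : ℝ) : 0 < √(m ^ 2 + p ^ 2) :=
  Real.sqrt_pos.2 (by positivity)

theorem hasDerivAt_strainFamily (b v : ℝ → ℝ) {m : ℝ} (hm : m ≠ 0) (p x : ℝ) :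
    HasDerivAt (fun p => strainFamily b v m p x)
      ((p ^ 3 + m ^ 2 * p + m ^ 3 * b x) / √(m ^ 2 + p ^ 2) ^ 3) p := by
  have hs := sqrt_sq_add_sq_pos hm p
  have hsq : √(m ^ 2 + p ^ 2) ^ 2 = m ^ 2 + p ^ 2 := Real.sq_sqrt (by positivity)
  have h1 : HasDerivAt (fun p => √(m ^ 2 + p ^ 2)) (p / √(m ^ 2 + p ^ 2)) p := by
    have h0 : HasDerivAt (fun p : ℝ => m ^ 2 + p ^ 2) (2 * p) p := by
      simpa using (hasDerivAt_pow 2 p).const_add (m ^ 2)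
    refine (h0.sqrt (by positivity)).congr_deriv ?_
    field_simp
  have h2 : HasDerivAt (fun p => m * p * b x) (m * b x) p := by
    simpa using ((hasDerivAt_id p).const_mul m).mul_const (b x)
  refine ((h1.add (h2.div h1 hs.ne')).add_const (m * v x)).congr_deriv ?_
  generalize √(m ^ 2 + p ^ 2) = s at *
  field_simp
  linear_combination (p + m * b x) * hsq

theorem tendsto_strainFamily (b v : ℝ → ℝ) (m x : ℝ) {l : Filter ℝ}
    (hl : Tendsto (fun p : ℝ => |p|) l atTop) :
    Tendsto (fun p => strainFamily b v m p x) l atTop := by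
  refine tendsto_atTop_mono (fun p => ?_) (tendsto_atTop_add_const_right l (-|m * b x| + m * v x) hl)
  have h1 : |p| ≤ √(m ^ 2 + p ^ 2) := Real.abs_le_sqrt (by nlinarith [sq_nonneg m])
  have h2 : |p / √(m ^ 2 + p ^ 2) * (m * b x)| ≤ |m * b x| := by
    rw [abs_mul]
    exact mul_le_of_le_one_left (abs_nonneg _) (abs_div_sqrt_add_sq_le_one m p)
  have h3 : m * p * b x / √(m ^ 2 + p ^ 2) = p / √(m ^ 2 + p ^ 2) * (m * b x) := by ring
  have h4 := (abs_le.1 h2).1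
  simp only [strainFamily]
  linarith

/-- Existence of the effective Hamiltonian. Its level lies below `|m| + m v x` for some `x`,
or the corrector is `C¹`. The numerator of `∂H/∂p` is an increasing cubic in `p`, which makes the
Hamiltonian strictly quasiconvex. -/
theorem exists_cellProblemSolvable_strainFamily {b v : ℝ → ℝ} (hb : Continuous b)
    (hbp : Function.Periodic b 1) (hv : Continuous v) (hvp : Function.Periodic v 1) {m : ℝ}
    (hm : m ≠ 0) (n : ℝ) :
    ∃ a, CellProblemSolvable (strainFamily b v m) n a ∧ ((∃ x, a ≤ |m| + m * v x) ∨
      ∃ q : ℝ → ℝ, Continuous q ∧ Function.Periodic q 1 ∧ ∫ x in (0 : ℝ)..1, q x = n ∧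
        ∀ x, strainFamily b v m (q x) x = a) := by
  have hcub : ∀ x, StrictMono fun p : ℝ => p ^ 3 + m ^ 2 * p + m ^ 3 * b x := fun x p q hpq => by
    have h1 : p ^ 3 < q ^ 3 := Odd.strictMono_pow (by decide) hpq
    have h2 : m ^ 2 * p < m ^ 2 * q := mul_lt_mul_of_pos_left hpq (by positivity)
    simp only
    linarith
  have hcubBot : Tendsto (fun p : ℝ => p ^ 3) atBot atBot :=
    (tendsto_neg_atTop_atBot.comp ((tendsto_pow_atTop three_ne_zero).comp
      tendsto_neg_atBot_atTop)).congr fun p => by simp only [Function.comp_apply]; ring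
  obtain ⟨P, hP, hPc⟩ := exists_continuous_inverse
    (K := fun p x => p ^ 3 + m ^ 2 * p + m ^ 3 * b x) (by fun_prop) hcub
    (fun x => tendsto_atTop_add_const_right _ _ ((tendsto_pow_atTop (by norm_num)).atTop_add_atTop
      (tendsto_id.const_mul_atTop (by positivity))))
    (fun x => tendsto_atBot_add_const_right _ _ (Tendsto.atBot_add_atBot
      hcubBot (tendsto_id.const_mul_atBot (by positivity))))
  have hcont : Continuous fun z : ℝ × ℝ => strainFamily b v m z.1 z.2 := by
    have : ∀ z : ℝ × ℝ, √(m ^ 2 + z.1 ^ 2) ≠ 0 := fun z => (sqrt_sq_add_sq_pos hm z.1).ne'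
    simp only [strainFamily]
    fun_prop (disch := assumption)
  have hcx : ∀ x, Continuous fun p => strainFamily b v m p x := fun x =>
    hcont.comp (by fun_prop : Continuous fun p : ℝ => (p, x))
  have hmono : ∀ x, StrictMonoOn (fun p => strainFamily b v m p x) (Ici (P 0 x)) := fun x =>
    strictMonoOn_of_deriv_pos (convex_Ici _) (hcx x).continuousOn fun p hp => by
      rw [interior_Ici] at hp
      rw [(hasDerivAt_strainFamily b v hm p x).deriv]
      have := hcub x hp
      simp only [hPc] at this
      exact div_pos this (pow_pos (sqrt_sq_add_sq_pos hm p) 3)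
  have hanti : ∀ x, StrictAntiOn (fun p => strainFamily b v m p x) (Iic (P 0 x)) := fun x =>
    strictAntiOn_of_deriv_neg (convex_Iic _) (hcx x).continuousOn fun p hp => by
      rw [interior_Iic] at hp
      rw [(hasDerivAt_strainFamily b v hm p x).deriv]
      have := hcub x hp
      simp only [hPc] at this
      exact div_neg_of_neg_of_pos this (pow_pos (sqrt_sq_add_sq_pos hm p) 3)
  obtain ⟨a, ha, h⟩ := exists_cellProblemSolvable_of_quasiconvex hcont
    (fun p x => by simp only [strainFamily, hbp x, hvp x])
    (hP.comp (by fun_prop : Continuous fun x : ℝ => ((0 : ℝ), x)))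
    (fun x => (hcub x).injective (by
      have h1 := hPc 0 (x + 1)
      rw [hbp] at h1
      exact h1.trans (hPc 0 x).symm))
    hmono hanti (fun x => tendsto_strainFamily b v m x tendsto_abs_atTop_atTop)
    (fun x => tendsto_strainFamily b v m x tendsto_abs_atBot_atTop) n
  refine ⟨a, ha, h.imp (fun ⟨x, hx⟩ => ⟨x, ?_⟩) id⟩
  have h0 : strainFamily b v m 0 x = |m| + m * v x := by
    simp [strainFamily, Real.sqrt_sq_eq_abs]
  rw [← h0, hx]
  rcases le_total (P 0 x) 0 with h | h
  · exact (hmono x).monotoneOn self_mem_Ici h h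
  · exact (hanti x).antitoneOn h self_mem_Iic h

theorem existsUnique_cellProblemSolvable_strainFamily {b v : ℝ → ℝ} (hb : Continuous b)
    (hbp : Function.Periodic b 1) (hv : Continuous v) (hvp : Function.Periodic v 1) (m n : ℝ) :
    ∃! a, CellProblemSolvable (strainFamily b v m) n a := by
  refine existsUnique_of_exists_of_unique ?_ fun a a' =>
    cellProblemSolvable_strainFamily_unique hb hbp hv hvp
  rcases eq_or_ne m 0 with rfl | hm
  · -- The Hamiltonian is `|p|`, and constants are correctors.
    have h := cellProblemSolvable_of_continuous (H := strainFamily b v 0) (a := |n|)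
      (q := fun _ => n) continuous_const (fun _ => rfl)
      (fun x => by simp [strainFamily, Real.sqrt_sq_eq_abs])
    exact ⟨|n|, by simpa using h⟩
  · obtain ⟨a, ha, -⟩ := exists_cellProblemSolvable_strainFamily hb hbp hv hvp hm n
    exact ⟨a, ha⟩

/-! ### Comparison of the two effective Hamiltonians -/

/-- The equality form of the Cauchy–Schwarz inequality for the vectors `(m, p)` and
`(m, p + m β)`. -/
theorem strain_sq_add_sq {m : ℝ} (hm : m ≠ 0) (p β : ℝ) :
    (√(m ^ 2 + p ^ 2) + m * p * β / √(m ^ 2 + p ^ 2)) ^ 2 + (m ^ 2 * β / √(m ^ 2 + p ^ 2)) ^ 2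
      = m ^ 2 + (p + m * β) ^ 2 := by
  have hs := sqrt_sq_add_sq_pos hm p
  have hsq : √(m ^ 2 + p ^ 2) ^ 2 = m ^ 2 + p ^ 2 := Real.sq_sqrt (by positivity)
  generalize √(m ^ 2 + p ^ 2) = s at *
  field_simp
  linear_combination (s ^ 2 - (m * β) ^ 2) * hsq

theorem shearStrainHamiltonian_le (v : ℝ → ℝ) (m p x : ℝ) :
    shearStrainHamiltonian v m p x ≤ shearHamiltonian v m (p + m * deriv v x) x := by
  simp only [shearStrainHamiltonian, shearHamiltonian]
  gcongr
  rcases eq_or_ne m 0 with rfl | hm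
  · simp
  · refine Real.le_sqrt_of_sq_le ?_
    rw [← strain_sq_add_sq hm]
    exact le_add_of_nonneg_right (sq_nonneg _)

/-- Adding `m v` to a corrector of the strained problem gives a supersolution of the unstrained
one at the same level. -/
theorem isViscositySupersolution_add_mul {v u : ℝ → ℝ} (hv : ContDiff ℝ 1 v) {m n a : ℝ}
    (hu : IsViscositySupersolution (fun p x => shearStrainHamiltonian v m (n + p) x - a) u) :
    IsViscositySupersolution (fun p x => shearHamiltonian v m (n + p) x - a)
      (fun x => u x + m * v x) := by
  refine ⟨hu.1.add (continuous_const.mul hv.continuous), fun φ hφ x₀ hx₀ => ?_⟩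
  have h := hu.2 (fun x => φ x - m * v x) (hφ.sub (contDiff_const.mul hv)) x₀
    (fun x => by linarith [hx₀ x])
  have hd : deriv (fun x => φ x - m * v x) x₀ = deriv φ x₀ - m * deriv v x₀ :=
    ((hφ.differentiable one_ne_zero x₀).hasDerivAt.sub
      ((hv.differentiable one_ne_zero x₀).hasDerivAt.const_mul m)).deriv
  have h' := shearStrainHamiltonian_le v m (n + (deriv φ x₀ - m * deriv v x₀)) x₀
  rw [show n + (deriv φ x₀ - m * deriv v x₀) + m * deriv v x₀ = n + deriv φ x₀ by ring] at h'
  rw [hd] at h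
  simp only at h ⊢
  linarith

theorem forall_pos_or_forall_neg_of_continuous {f : ℝ → ℝ} (hf : Continuous f)
    (h0 : ∀ x, f x ≠ 0) : (∀ x, 0 < f x) ∨ ∀ x, f x < 0 := by
  by_contra! h
  obtain ⟨⟨x, hx⟩, ⟨y, hy⟩⟩ := h
  obtain ⟨z, hz⟩ := mem_range_of_exists_le_of_exists_ge hf ⟨x, hx⟩ ⟨y, hy⟩
  exact h0 z hz

/-- Two continuous functions with the same mean are equal if one dominates the other in absolute
value and neither vanishes, for they cannot have opposite signs. -/
theorem eqOn_Icc_of_integral_eq_of_abs_le {f g : ℝ → ℝ} (hf : Continuous f) (hg : Continuous g)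
    (h0 : ∀ x, g x ≠ 0) (hle : ∀ x, |g x| ≤ |f x|)
    (hint : ∫ x in (0 : ℝ)..1, f x = ∫ x in (0 : ℝ)..1, g x) : EqOn f g (Icc 0 1) := by
  have key : ∀ f g : ℝ → ℝ, Continuous f → Continuous g → (∀ x, 0 < g x) →
      (∀ x, |g x| ≤ |f x|) → ∫ x in (0 : ℝ)..1, f x = ∫ x in (0 : ℝ)..1, g x →
      EqOn f g (Icc 0 1) := by
    intro f g hf hg hpos hle hint x hx
    have hg1 : 0 < ∫ x in (0 : ℝ)..1, g x :=
      intervalIntegral.intervalIntegral_pos_of_pos (hg.intervalIntegrable _ _) hpos one_pos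
    rcases forall_pos_or_forall_neg_of_continuous hf
      (fun x => abs_pos.1 ((abs_pos.2 (hpos x).ne').trans_le (hle x))) with hfp | hfn
    · have hle' : ∀ x, g x ≤ f x := fun x => by
        simpa only [abs_of_pos (hpos x), abs_of_pos (hfp x)] using hle x
      by_contra hne
      exact (intervalIntegral.integral_lt_integral_of_continuousOn_of_le_of_exists_lt one_pos
        hg.continuousOn hf.continuousOn (fun x _ => hle' x)
        ⟨x, hx, lt_of_le_of_ne (hle' x) (Ne.symm hne)⟩).ne' hint
    · have hf1 : 0 < ∫ x in (0 : ℝ)..1, -f x :=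
        intervalIntegral.intervalIntegral_pos_of_pos (hf.neg.intervalIntegrable _ _)
          (fun x => neg_pos.2 (hfn x)) one_pos
      rw [intervalIntegral.integral_neg] at hf1
      linarith
  rcases forall_pos_or_forall_neg_of_continuous hg h0 with hp | hn
  · exact key f g hf hg hp hle hint
  · have := key (fun x => -f x) (fun x => -g x) hf.neg hg.neg (fun x => neg_pos.2 (hn x))
      (fun x => by simpa using hle x)
      (by rw [intervalIntegral.integral_neg, intervalIntegral.integral_neg, hint])
    exact fun x hx => neg_injective (this hx)

/-- At a level above `|m| + m v` with `C¹` correctors of both problems, of slopes `q` and `q₀`,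
the strain vanishes: `q + m v'` has the mean of `q₀` and dominates it in absolute value. -/
theorem deriv_eq_zero_of_common_level {v q q₀ : ℝ → ℝ} (hv : ContDiff ℝ 1 v)
    (hvp : Function.Periodic v 1) {m a : ℝ} (hm : m ≠ 0) (ha : ∀ x, |m| + m * v x < a)
    (hq : Continuous q) (hq₀ : Continuous q₀)
    (hint : ∫ x in (0 : ℝ)..1, q x = ∫ x in (0 : ℝ)..1, q₀ x)
    (hHq : ∀ x, shearStrainHamiltonian v m (q x) x = a)
    (hHq₀ : ∀ x, shearHamiltonian v m (q₀ x) x = a) (x : ℝ) : deriv v x = 0 := by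
  have hdc : Continuous (deriv v) := hv.continuous_deriv le_rfl
  have hmdc : Continuous fun x => m * deriv v x := continuous_const.mul hdc
  have hsq : ∀ x, (q x + m * deriv v x) ^ 2
      = q₀ x ^ 2 + (m ^ 2 * deriv v x / √(m ^ 2 + q x ^ 2)) ^ 2 := fun x => by
    have h1 := strain_sq_add_sq hm (q x) (deriv v x)
    have h2 : √(m ^ 2 + q x ^ 2) + m * q x * deriv v x / √(m ^ 2 + q x ^ 2)
        = √(m ^ 2 + q₀ x ^ 2) := by
      have h3 := (hHq x).trans (hHq₀ x).symm
      simp only [shearStrainHamiltonian, shearHamiltonian] at h3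
      linarith
    rw [h2, Real.sq_sqrt (by positivity)] at h1
    linarith
  have hne : ∀ x, q₀ x ≠ 0 := fun x hx => by
    have h1 := hHq₀ x
    rw [shearHamiltonian, hx, zero_pow two_ne_zero, add_zero, Real.sqrt_sq_eq_abs] at h1
    exact (ha x).ne h1
  have hmean : ∫ x in (0 : ℝ)..1, (q x + m * deriv v x) = ∫ x in (0 : ℝ)..1, q₀ x := by
    have h1 : v 1 = v 0 := by simpa using hvp 0
    rw [intervalIntegral.integral_add (hq.intervalIntegrable _ _)
      (hmdc.intervalIntegrable _ _), intervalIntegral.integral_const_mul,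
      intervalIntegral.integral_deriv_eq_sub (fun x _ => hv.differentiable one_ne_zero x)
        (hdc.intervalIntegrable _ _), h1, sub_self, mul_zero, add_zero, hint]
  have heq := eqOn_Icc_of_integral_eq_of_abs_le (f := fun x => q x + m * deriv v x)
    (hq.add hmdc) hq₀ hne
    (fun x => sq_le_sq.1 ((hsq x).symm ▸ le_add_of_nonneg_right (sq_nonneg _))) hmean
  have hdp : Function.Periodic (deriv v) 1 := fun x => by
    rw [← deriv_comp_add_const, funext hvp]
  obtain ⟨y, hy, hxy⟩ := hdp.exists_mem_Ico₀ one_pos x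
  have h1 := hsq y
  have h2 : q y + m * deriv v y = q₀ y := heq ⟨hy.1, hy.2.le⟩
  rw [h2, left_eq_add, sq_eq_zero_iff,
    div_eq_zero_iff, or_iff_left (sqrt_sq_add_sq_pos hm _).ne'] at h1
  rw [hxy]
  exact (mul_eq_zero.1 h1).resolve_left (pow_ne_zero 2 hm)

theorem theorem2p2 (v : ℝ → ℝ) (hv : ContDiff ℝ ∞ v) (hper : Function.Periodic v 1)
    (hmean : ∫ x in (0 : ℝ)..1, v x = 0) (m n : ℝ) :
    (∃! lam : ℝ, CellProblemSolvable (shearHamiltonian v m) n lam) ∧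
    (∃! lamHat : ℝ, CellProblemSolvable (shearStrainHamiltonian v m) n lamHat) ∧
    ∀ lam lamHat : ℝ,
      CellProblemSolvable (shearHamiltonian v m) n lam →
      CellProblemSolvable (shearStrainHamiltonian v m) n lamHat →
      lamHat ≤ lam ∧
      (m ≠ 0 → |m| + (⨆ x : ℝ, m * v x) < lam →
        (lam = lamHat ↔ ∀ x : ℝ, deriv v x = 0)) := by
  have hv1 : ContDiff ℝ 1 v := hv.of_le (by norm_cast)
  have hvc := hv1.continuous
  have hdc : Continuous (deriv v) := hv1.continuous_deriv le_rfl
  have hdp : Function.Periodic (deriv v) 1 := fun x => by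
    rw [← deriv_comp_add_const, funext hper]
  have hzc : Continuous fun _ : ℝ => (0 : ℝ) := continuous_const
  have hzp : Function.Periodic (fun _ : ℝ => (0 : ℝ)) 1 := fun _ => rfl
  have hex := existsUnique_cellProblemSolvable_strainFamily hzc hzp hvc hper m n
  have hmod := strainFamily_modulus hzc hzp hvc hper m
  have hexq := fun hm : m ≠ 0 =>
    exists_cellProblemSolvable_strainFamily hzc hzp hvc hper hm n
  rw [strainFamily_zero] at hex hmod
  simp only [strainFamily_zero] at hexq
  have hexHat : ∃! lamHat : ℝ, CellProblemSolvable (shearStrainHamiltonian v m) n lamHat :=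
    existsUnique_cellProblemSolvable_strainFamily hdc hdp hvc hper m n
  refine ⟨hex, hexHat, fun lam lamHat h hHat => ⟨?_, fun hm hlam => ⟨?_, fun hd => ?_⟩⟩⟩
  · obtain ⟨u, hu, hus⟩ := h
    obtain ⟨w, hw, hws⟩ := hHat
    exact level_le_of_subsolution_of_supersolution hmod hu
      (fun x => by simp only [hw x, hper x]) hus.1 (isViscositySupersolution_add_mul hv1 hws.2)
  · rintro rfl
    have hlt : ∀ x, |m| + m * v x < lam := fun x => by
      have hp : Function.Periodic (fun x => m * v x) 1 := fun x => by simp only [hper x]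
      have hbdd : BddAbove (range fun x => m * v x) :=
        (hp.isBounded_of_continuous one_ne_zero (continuous_const.mul hvc)).bddAbove
      linarith [le_ciSup hbdd x]
    obtain ⟨a, ha, hq₀⟩ := hexq hm
    obtain ⟨a', ha', hq⟩ := exists_cellProblemSolvable_strainFamily hdc hdp hvc hper hm n
    obtain rfl := hex.unique h ha
    obtain rfl := hexHat.unique hHat ha'
    obtain ⟨q₀, hq₀c, -, hq₀n, hHq₀⟩ := hq₀.resolve_left fun ⟨x, hx⟩ => (hlt x).not_ge hx
    obtain ⟨q, hqc, -, hqn, hHq⟩ := hq.resolve_left fun ⟨x, hx⟩ => (hlt x).not_ge hx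
    exact deriv_eq_zero_of_common_level hv1 hper hm hlt hqc hq₀c (hqn.trans hq₀n.symm) hHq hHq₀
  · have e : shearStrainHamiltonian v m = shearHamiltonian v m := by
      funext p x
      simp [shearStrainHamiltonian, shearHamiltonian, hd x]
    rw [e] at hHat
    exact hex.unique h hHat
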